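/- **Theorem 1.9 ($\mathfrak g$-inclusion).** Let $G$ be a (finite-dimensional real) Lie group with Lie algebra $\mathfrak g$ (bracket of left-invariant vector fields), equipped with an $\mathrm{ad}$-invariant nondegenerate symmetric bilinear form $\langle\cdot,\cdot\rangle$, not necessarily definite, which is used to identify $\mathfrak g^*\cong\mathfrak g$. For $\xi\in\mathfrak g$ let $\xi^L,\xi^R$ be the left- and right-invariant vector fields on $G$ with value $\xi$ at the unit, let $\theta^L\in\Omega^1(G,\mathfrak g)$ be the Maurer–Cartan form with $\theta^L(\xi^L)=\xi$, and let $b:G\times\mathfrak g\to TG$, $b(g,\xi)=\tfrac12(\xi^L(g)+\xi^R(g))$. Let $\phi\in\wedge^3\mathfrak g$ be $\phi(\alpha,\beta,\gamma)=\tfrac12\,\alpha([\beta,\gamma])$ for $\alpha,\beta,\gamma\in\mathfrak g^*\cong\mathfrak g$. Let $(M,\rho,\pi,\Phi)$ be a Hamiltonian quasi-Poisson $\mathfrak g$-manifold. That is, $M$ is a smooth manifold; $\rho:\mathfrak g\to\Gamma(TM)$ is a morphism of Lie algebras; $\pi\in\Gamma(\wedge^2TM)$ is a bivector field which, for the Schouten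 bracket, satisfies $$[\pi,\pi]=\rho(\phi),\qquad [\pi,\rho(\xi)]=0\quad(\xi\in\mathfrak g)$$ (the second condition says that $\pi$ is $\mathfrak g$-invariant); and $\Phi:M\to G$ is a smooth map which is $\mathfrak g$-equivariant, i.e. $\Phi_*\rho(\xi)=(\xi^L-\xi^R)\circ\Phi$ for all $\xi\in\mathfrak g$, and satisfies $\pi^\sharp(\Phi^*\alpha)=\rho(\Phi^*(b^*\alpha))$ for all $\alpha\in\Omega^1(G)$, where $\beta(\pi^\sharp(\alpha))=\pi(\alpha,\beta)$ and $b^*\alpha$ is regarded as a $\mathfrak g$-valued function on $G$. Equip $T^*M$ with the Lie algebroid structure whose anchor is $\mathbf a=\pi^\sharp+\tfrac12\rho\circ\rho^*:T^*M\to TM$, where $\rho^*:T^*M\to M\times\mathfrak g^*\cong M\times\mathfrak g$ is the transpose of $\rho$, and whose bracket on $\Omega^1(M)$ is $$[\alpha,\beta]=d\pi(\alpha,\beta)+\iota_{\pi^\sharp(\alpha)}d\beta-\iota_{\pi^\sharp(\beta)}d\alpha+\tfrac12\sum_i\Big(\alpha(\rho(e^i))\,\mathcal L_{\rho(e_i)}\beta-\beta(\rho(e^i))\,\mathcal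 L_{\rho(e_i)}\alpha\Big),$$ for any two bases $(e_i)$, $(e^i)$ of $\mathfrak g$ dual with respect to $\langle\cdot,\cdot\rangle$. Then $$i:\mathfrak g\to\Omega^1(M),\qquad i(\xi)=\Phi^*\langle\xi,\theta^L\rangle$$ takes values in smooth one-forms and is a morphism of Lie algebras, i.e. it is $\mathbb R$-linear and $i([\xi,\eta])=[i(\xi),i(\eta)]$ for all $\xi,\eta\in\mathfrak g$; moreover $\mathbf a\circ i=\rho$. -/

import Mathlib

open scoped Manifold ContDiff Bundle

noncomputable section

namespace QPoisson

/-! ### Tangent and cotangent vectors, smooth tensor fields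

Manifolds are smooth manifolds without boundary, modelled on `ℝᵐ`. -/

section Fields

variable (m : ℕ) {M : Type*} [TopologicalSpace M]
  [ChartedSpace (EuclideanSpace ℝ (Fin m)) M]

/-- The tangent space `T_x M`. -/
abbrev Tan (x : M) : Type := TangentSpace (𝓡 m) x

/-- The cotangent space `T_x^* M`. -/
abbrev Cot (x : M) : Type := Tan m x →L[ℝ] ℝ

variable (M) in
/-- Smooth vector fields on `M`. -/
abbrev VectorField [IsManifold (𝓡 m) ∞ M] :=
  ContMDiffSection (𝓡 m) (EuclideanSpace ℝ (Fin m)) ∞ (fun x : M => Tan m x)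

variable (M) in
/-- Smooth one-forms on `M`. -/
abbrev OneForm [IsManifold (𝓡 m) ∞ M] :=
  ContMDiffSection (𝓡 m) (EuclideanSpace ℝ (Fin m) →L[ℝ] ℝ) ∞ (fun x : M => Cot m x)

variable (M) in
/-- Smooth sections of the bundle `Hom(T^*M, TM)`. -/
abbrev CotToTanField [IsManifold (𝓡 m) ∞ M] :=
  ContMDiffSection (𝓡 m)
    ((EuclideanSpace ℝ (Fin m) →L[ℝ] ℝ) →L[ℝ] EuclideanSpace ℝ (Fin m)) ∞
    (fun x : M => Cot m x →L[ℝ] Tan m x)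

variable (M) in
/-- A smooth bivector field `π ∈ Γ(∧² TM)`, given through the map `π^♯ : T^*M → TM` with
`β (π^♯ α) = π(α, β)`; in finite dimension `∧² T_x M` is the space of those linear maps
`T_x^* M → T_x M` for which this form is alternating. -/
structure Bivector [IsManifold (𝓡 m) ∞ M] where
  sharp : CotToTanField m M
  alternating : ∀ (x : M) (α : Cot m x), α (sharp x α) = 0

/-- The value `P_x(α, β)`. -/
def Bivector.eval {m : ℕ} {M : Type*} [TopologicalSpace M]
    [ChartedSpace (EuclideanSpace ℝ (Fin m)) M] [IsManifold (𝓡 m) ∞ M]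
    (P : Bivector m M) (x : M) (α β : Cot m x) : ℝ :=
  β (P.sharp x α)

/-- The differential at `x` of a real function. -/
def dFun (f : M → ℝ) (x : M) : Cot m x :=
  mfderiv (𝓡 m) 𝓘(ℝ, ℝ) f x

/-- Near `x`, the vector field with constant coefficients in the chart at `x` and with value `v`
at `x`. (`T_x M` is identified with `ℝᵐ` by the chart at `x`.) -/
def constField {x : M} (v : Tan m x) (y : M) : Tan m y :=
  mfderiv 𝓘(ℝ, EuclideanSpace ℝ (Fin m)) (𝓡 m) (extChartAt (𝓡 m) x).symm
    (extChartAt (𝓡 m) x y) v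

/-- Near `x`, the one-form with constant coefficients in the chart at `x` and with value `α`
at `x`. -/
def constForm {x : M} (α : Cot m x) (y : M) : Cot m y :=
  ContinuousLinearMap.comp (M₂ := EuclideanSpace ℝ (Fin m)) α
    (mfderiv (𝓡 m) 𝓘(ℝ, EuclideanSpace ℝ (Fin m)) (extChartAt (𝓡 m) x) y)

/-- The exterior derivative of a one-form at `x`, as a bilinear form on `T_x M`:
`dα(v, w) = v (α(W)) - w (α(V))`, where `V`, `W` extend `v`, `w` and have constant coefficients in
the chart at `x` (so that they commute). -/
def extD (α : (x : M) → Cot m x) (x : M) (v w : Tan m x) : ℝ :=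
  dFun m (fun y => α y (constField m w y)) x v - dFun m (fun y => α y (constField m v y)) x w

/-- The Lie derivative of a one-form along a vector field, `L_X α = ι_X dα + d(α(X))`,
evaluated on `v ∈ T_x M`. -/
def lieD (X : (x : M) → Tan m x) (α : (x : M) → Cot m x) (x : M) (v : Tan m x) : ℝ :=
  extD m α x (X x) v + dFun m (fun y => α y (X y)) x v

variable [IsManifold (𝓡 m) ∞ M]

/-- The Schouten bracket `[P, Q]` of two bivector fields, a trivector field, evaluated on
covectors at `x`. In coordinates
`[P, Q]^{ijk} = ∑_l (P^{il} ∂_l Q^{jk} + Q^{il} ∂_l P^{jk}) + cyclic permutations of i, j, k`,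
which is the bracket that extends the Lie bracket of vector fields by
`[X ∧ Y, Z ∧ W] = [X,Z] ∧ Y ∧ W - [X,W] ∧ Y ∧ Z - [Y,Z] ∧ X ∧ W + [Y,W] ∧ X ∧ Z`. -/
def schouten (P Q : Bivector m M) (x : M) (α β γ : Cot m x) : ℝ :=
  let D (R S : Bivector m M) (a b c : Cot m x) : ℝ :=
    dFun m (fun y => S.eval y (constForm m b y) (constForm m c y)) x (R.sharp x a)
  (D P Q α β γ + D P Q β γ α + D P Q γ α β) + (D Q P α β γ + D Q P β γ α + D Q P γ α β)

/-- The Schouten bracket `[P, X] = - L_X P` of a bivector field and a vector field, evaluated on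
covectors at `x`. Here
`(L_X P)(α, β) = X (P(α, β)) - P(L_X α, β) - P(α, L_X β)`, where `α`, `β` are extended by the closed
forms with constant coefficients, so that `L_X α = d(α(X))`. -/
def schoutenVec (P : Bivector m M) (X : VectorField m M) (x : M) (α β : Cot m x) : ℝ :=
  -(dFun m (fun y => P.eval y (constForm m α y) (constForm m β y)) x (X x)
      - P.eval x (dFun m (fun y => constForm m α y (X y)) x) β
      - P.eval x α (dFun m (fun y => constForm m β y (X y)) x))

end Fields

/-! ### Quadratic Lie algebras and quasi-Poisson manifolds -/

/-- An `ad`-invariant, nondegenerate, symmetric (not necessarily definite) bilinear form on a Lie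
algebra. -/
structure InvariantInnerProduct (𝔤 : Type*) [LieRing 𝔤] [LieAlgebra ℝ 𝔤] where
  form : LinearMap.BilinForm ℝ 𝔤
  symm : ∀ ξ η : 𝔤, form ξ η = form η ξ
  nondegenerate : form.Nondegenerate
  invariant : ∀ ξ η ζ : 𝔤, form ⁅ξ, η⁆ ζ = form ξ ⁅η, ζ⁆

section Quadratic

variable {𝔤 : Type*} [LieRing 𝔤] [LieAlgebra ℝ 𝔤] [FiniteDimensional ℝ 𝔤]

/-- The identification `s^♯ : 𝔤^* → 𝔤` given by the inner product: `⟨s^♯ a, η⟩ = a(η)`. -/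
def InvariantInnerProduct.sSharp (B : InvariantInnerProduct 𝔤) :
    Module.Dual ℝ 𝔤 ≃ₗ[ℝ] 𝔤 :=
  (B.form.toDual B.nondegenerate).symm

/-- The trivector `φ ∈ ∧³ 𝔤`, `φ(a, b, c) = ½ a([s^♯ b, s^♯ c])`. -/
def InvariantInnerProduct.phi (B : InvariantInnerProduct 𝔤) (a b c : Module.Dual ℝ 𝔤) : ℝ :=
  (1 / 2) * a ⁅B.sSharp b, B.sSharp c⁆

variable (m : ℕ) (M : Type*) [TopologicalSpace M]
  [ChartedSpace (EuclideanSpace ℝ (Fin m)) M] [IsManifold (𝓡 m) ∞ M]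

variable {m M} in
/-- The transpose `ρ_x^* : T_x^* M → 𝔤^*` of `ρ_x : 𝔤 → T_x M`. -/
def transpose (ρ : 𝔤 →ₗ[ℝ] VectorField m M) (x : M) (α : Cot m x) : Module.Dual ℝ 𝔤 where
  toFun ξ := α (ρ ξ x)
  map_add' ξ η := by simp
  map_smul' c ξ := by simp

/-- A quasi-Poisson `𝔤`-structure on `M`: an infinitesimal action `ρ` of `𝔤` (a morphism of Lie
algebras into the smooth vector fields) and a bivector field `π = biv` with `[π, π] = ρ(φ)` and
`[π, ρ(ξ)] = 0`; the latter says that `π` is `𝔤`-invariant. The trivector field `ρ(φ)` is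
evaluated on covectors by means of the transpose of `ρ`. -/
structure QuasiPoisson (B : InvariantInnerProduct 𝔤) where
  ρ : 𝔤 →ₗ[ℝ] VectorField m M
  ρ_lie : ∀ (ξ η : 𝔤) (x : M), ρ ⁅ξ, η⁆ x = VectorField.mlieBracket (𝓡 m) (ρ ξ) (ρ η) x
  biv : Bivector m M
  schouten_self : ∀ (x : M) (α β γ : Cot m x),
    schouten m biv biv x α β γ = B.phi (transpose ρ x α) (transpose ρ x β) (transpose ρ x γ)
  schouten_action : ∀ (ξ : 𝔤) (x : M) (α β : Cot m x), schoutenVec m biv (ρ ξ) x α β = 0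

variable {m M} {B : InvariantInnerProduct 𝔤}

/-- The anchor `𝐚 = π^♯ + ½ ρ ∘ ρ^*` of the Lie algebroid `T^*M`, with `𝔤^*` identified with `𝔤`. -/
def QuasiPoisson.anchor (Q : QuasiPoisson m M B) (x : M) (α : Cot m x) : Tan m x :=
  Q.biv.sharp x α + (1 / 2 : ℝ) • Q.ρ (B.sSharp (transpose Q.ρ x α)) x

/-- The bracket of one-forms of the Lie algebroid `T^*M`, evaluated on `v ∈ T_x M`:
`[α, β] = d(π(α, β)) + ι_{π^♯ α} dβ - ι_{π^♯ β} dα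
  + ½ ∑ᵢ (α(ρ(e^i)) L_{ρ(e_i)} β - β(ρ(e^i)) L_{ρ(e_i)} α)`,
where `e i = e_i` and `e' i = e^i` are bases of `𝔤` that are dual for the inner product. -/
def QuasiPoisson.bracket (Q : QuasiPoisson m M B) {ι : Type*} [Fintype ι]
    (e e' : Module.Basis ι ℝ 𝔤) (α β : OneForm m M) (x : M) (v : Tan m x) : ℝ :=
  dFun m (fun y => Q.biv.eval y (α y) (β y)) x v
    + extD m β x (Q.biv.sharp x (α x)) v - extD m α x (Q.biv.sharp x (β x)) v
    + (1 / 2) * ∑ i, (α x (Q.ρ (e' i) x) * lieD m (Q.ρ (e i)) β x v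
        - β x (Q.ρ (e' i) x) * lieD m (Q.ρ (e i)) α x v)

end Quadratic

/-! ### Lie groups and moment maps -/

section LieGroups

variable {n : ℕ} {G : Type*} [TopologicalSpace G]
  [ChartedSpace (EuclideanSpace ℝ (Fin n)) G] [Group G]

instance instLieGroupMinSmoothness [LieGroup (𝓡 n) ∞ G] :
    LieGroup (𝓡 n) (minSmoothness ℝ 3) G := by
  rw [minSmoothness_of_isRCLikeNormedField]
  infer_instance

instance instFiniteDimensionalTangentSpace {m : ℕ} {M : Type*} [TopologicalSpace M]
    [ChartedSpace (EuclideanSpace ℝ (Fin m)) M] (x : M) :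
    FiniteDimensional ℝ (TangentSpace (𝓡 m) x) :=
  inferInstanceAs (FiniteDimensional ℝ (EuclideanSpace ℝ (Fin m)))

variable (n G) in
/-- The Lie algebra of `G`: the tangent space at `1`, with the bracket of left-invariant vector
fields. -/
abbrev LieAlg : Type := GroupLieAlgebra (𝓡 n) G

/-- The left-invariant vector fields: `leftField g ξ = ξ^L(g)`. -/
def leftField (g : G) : LieAlg n G →L[ℝ] Tan n g :=
  mfderiv (𝓡 n) (𝓡 n) (fun h : G => g * h) 1

/-- The right-invariant vector fields: `rightField g ξ = ξ^R(g)`. -/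
def rightField (g : G) : LieAlg n G →L[ℝ] Tan n g :=
  mfderiv (𝓡 n) (𝓡 n) (fun h : G => h * g) 1

/-- The left Maurer–Cartan form `θ^L`, that is, left translation of tangent vectors to `1`. -/
def thetaL (g : G) : Tan n g →L[ℝ] LieAlg n G :=
  mfderiv (𝓡 n) (𝓡 n) (fun h : G => g⁻¹ * h) g

/-- The bundle map `b : G × 𝔤 → TG`, `b(g, ξ) = ½ (ξ^L(g) + ξ^R(g))`. -/
def bMap (g : G) : LieAlg n G →L[ℝ] Tan n g :=
  (1 / 2 : ℝ) • (leftField g + rightField g)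

/-- The value at `g` of `b^* α`, a function on `G` with values in `𝔤^*`. -/
def bStar (g : G) (α : Cot n g) : Module.Dual ℝ (LieAlg n G) :=
  (α.comp (bMap g)).toLinearMap

/-- The pullback `(Φ^* α)_x` of a cotangent vector `α` at `Φ x`. -/
def pullCot {m : ℕ} {M : Type*} [TopologicalSpace M] [ChartedSpace (EuclideanSpace ℝ (Fin m)) M]
    (Φ : M → G) (x : M) (α : Cot n (Φ x)) : Cot m x :=
  α.comp (mfderiv (𝓡 m) (𝓡 n) Φ x)

/-- `Φ : M → G` is a moment map: it is smooth; it is `𝔤`-equivariant for the conjugation action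
`ξ ↦ ξ^L - ξ^R` of `𝔤` on `G`; and `π^♯(Φ^* α) = ρ(Φ^*(b^* α))` for every smooth one-form `α` on
`G`, with `𝔤^*` identified with `𝔤`. -/
structure IsMomentMap [LieGroup (𝓡 n) ∞ G] {B : InvariantInnerProduct (LieAlg n G)}
    {m : ℕ} {M : Type*} [TopologicalSpace M] [ChartedSpace (EuclideanSpace ℝ (Fin m)) M]
    [IsManifold (𝓡 m) ∞ M] (Q : QuasiPoisson m M B) (Φ : M → G) : Prop where
  smooth : ContMDiff (𝓡 m) (𝓡 n) ∞ Φ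
  equivariant : ∀ (ξ : LieAlg n G) (x : M),
    mfderiv (𝓡 m) (𝓡 n) Φ x (Q.ρ ξ x) = leftField (Φ x) ξ - rightField (Φ x) ξ
  moment : ∀ (α : OneForm n G) (x : M),
    Q.biv.sharp x (pullCot Φ x (α (Φ x))) = Q.ρ (B.sSharp (bStar (Φ x) (α (Φ x)))) x

end LieGroups

end QPoisson

end

noncomputable section

namespace QPoisson

open Filter Topology

/-! ### Left differences and the Maurer–Cartan form in the chart at the unit. -/

section Local

variable {n : ℕ} {G : Type*} [TopologicalSpace G]
  [ChartedSpace (EuclideanSpace ℝ (Fin n)) G] [Group G]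

/-! Write θ for the pulled-back Maurer–Cartan form and, at a point x, A = Ad of Φ(x)⁻¹, with A* its
transpose for the inner product. Equivariance gives θ(ρ(ζ)) = ζ - Aζ, hence ρ*(i(ξ)) = ξ - A*ξ. The
moment condition gives π^♯(i(ξ)) = ½ρ(ξ + A*ξ). Adding half of ρ applied to the former yields the
anchor identity (`anchor_mcForm`).

For the bracket, two differential facts are needed: the Maurer–Cartan equation dθ(v, w) = -[θ(v),
θ(w)] (`maurer_cartan`, `extD_mc`), and d(Aζ)(v) = -[θ(v), Aζ] (`hasFDerivAt_adInv`, `dFun_adInv`).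
They turn every term of the algebroid bracket into an expression in A, A* and the Lie bracket.

One algebraic fact is also needed: A A* = 1. Invariance under ad does not give it when G is
disconnected; it is read off from π(i(ξ), i(ξ)) = 0 (`form_isotropic`, `apply_adj`). All terms in A
and A* then cancel, and ad-invariance identifies the rest with ⟨[ξ, η], θ⟩ (`bracket_identity`).

The Maurer–Cartan equation itself is symmetry of a second derivative. In the chart at the unit, q ↦
f(p)⁻¹f(q) has differential (left-invariant frame) ∘ θ. Differentiating once more at q = p and
antisymmetrising leaves dθ plus the antisymmetrised derivative of the frame, which is the Lie
bracket. -/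

variable (n G) in
/-- The multiplication of `G` in the chart at `1`. -/
def chartMul (a b : EuclideanSpace ℝ (Fin n)) : EuclideanSpace ℝ (Fin n) :=
  extChartAt (𝓡 n) (1 : G) ((extChartAt (𝓡 n) (1 : G)).symm a * (extChartAt (𝓡 n) (1 : G)).symm b)

variable (n G) in
/-- The coordinates of the unit in the chart at `1`. -/
def chartOne : EuclideanSpace ℝ (Fin n) := extChartAt (𝓡 n) (1 : G) 1

variable (n G) in
/-- The frame of left-invariant vector fields in the chart at `1`. -/
def chartFrame (a : EuclideanSpace ℝ (Fin n)) :
    EuclideanSpace ℝ (Fin n) →L[ℝ] EuclideanSpace ℝ (Fin n) :=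
  fderiv ℝ (chartMul n G a) (chartOne n G)

lemma chart_symm_one : (extChartAt (𝓡 n) (1 : G)).symm (chartOne n G) = 1 :=
  extChartAt_to_inv (I := 𝓡 n) (1 : G)

lemma contMDiffAt_chart_one : ContMDiffAt (𝓡 n) 𝓘(ℝ, EuclideanSpace ℝ (Fin n)) ∞
    (extChartAt (𝓡 n) (1 : G)) (1 : G) :=
  contMDiffAt_extChartAt

lemma chartMul_one_left :
    chartMul n G (chartOne n G) =ᶠ[𝓝 (chartOne n G)] id := by
  filter_upwards [extChartAt_target_mem_nhds (I := 𝓡 n) (1 : G)] with b hb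
  simp only [chartMul, chart_symm_one, one_mul, (extChartAt (𝓡 n) (1 : G)).right_inv hb, id]

lemma chartFrame_one : chartFrame n G (chartOne n G) = ContinuousLinearMap.id ℝ _ := by
  rw [chartFrame, chartMul_one_left.fderiv_eq, fderiv_id]

variable (n) in
/-- The left difference `f(p)⁻¹ f(q)` in the chart at `1`. -/
def chartDiff {E : Type*} (f : E → G) (p q : E) : EuclideanSpace ℝ (Fin n) :=
  extChartAt (𝓡 n) (1 : G) ((f p)⁻¹ * f q)

lemma chartDiff_self {E : Type*} (f : E → G) (p : E) : chartDiff n f p p = chartOne n G := by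
  simp [chartDiff, chartOne]

variable {E : Type*} [NormedAddCommGroup E] [NormedSpace ℝ E]

variable (n) in
/-- The pullback along `f` of the left Maurer-Cartan form. -/
def pullMC (f : E → G) (p : E) : E →L[ℝ] EuclideanSpace ℝ (Fin n) :=
  fderiv ℝ (chartDiff n f p) p

/-- Left invariance of the Maurer–Cartan form: the factor `g` cancels in every left difference. -/
lemma pullMC_mul_left (g : G) (f : E → G) : pullMC n (fun p => g * f p) = pullMC n f := by
  have : chartDiff n (fun p => g * f p) = chartDiff n f := by
    ext1 p
    ext1 q
    simp only [chartDiff]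
    congr 1
    group
  unfold pullMC
  rw [this]

section
variable [LieGroup (𝓡 n) ∞ G]

lemma contMDiffAt_chart_symm : ContMDiffAt 𝓘(ℝ, EuclideanSpace ℝ (Fin n)) (𝓡 n) ∞
    (extChartAt (𝓡 n) (1 : G)).symm (chartOne n G) :=
  (contMDiffOn_extChartAt_symm (I := 𝓡 n) (n := ∞) (1 : G)).contMDiffAt
    (extChartAt_target_mem_nhds (I := 𝓡 n) (1 : G))

lemma contDiffAt_chartMul : ContDiffAt ℝ ∞
    (Function.uncurry (chartMul n G)) (chartOne n G, chartOne n G) := by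
  rw [← contMDiffAt_iff_contDiffAt]
  have h1 : ContMDiffAt 𝓘(ℝ, EuclideanSpace ℝ (Fin n) × EuclideanSpace ℝ (Fin n)) (𝓡 n) ∞
      (fun z : EuclideanSpace ℝ (Fin n) × EuclideanSpace ℝ (Fin n) =>
        (extChartAt (𝓡 n) (1 : G)).symm z.1) (chartOne n G, chartOne n G) :=
    ContMDiffAt.comp (chartOne n G, chartOne n G) (contMDiffAt_chart_symm (G := G))
      contDiff_fst.contMDiff.contMDiffAt
  have h2 : ContMDiffAt 𝓘(ℝ, EuclideanSpace ℝ (Fin n) × EuclideanSpace ℝ (Fin n)) (𝓡 n) ∞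
      (fun z : EuclideanSpace ℝ (Fin n) × EuclideanSpace ℝ (Fin n) =>
        (extChartAt (𝓡 n) (1 : G)).symm z.2) (chartOne n G, chartOne n G) :=
    ContMDiffAt.comp (chartOne n G, chartOne n G) (contMDiffAt_chart_symm (G := G))
      contDiff_snd.contMDiff.contMDiffAt
  have h3 := h1.mul h2
  refine ContMDiffAt.comp (I' := 𝓡 n) (M' := G) (chartOne n G, chartOne n G) ?_ h3
  simp only [chart_symm_one, mul_one]
  exact contMDiffAt_chart_one

lemma contDiffAt_chartFrame : ContDiffAt ℝ ∞ (chartFrame n G) (chartOne n G) :=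
  ContDiffAt.fderiv (n := ∞) (contDiffAt_chartMul (n := n) (G := G)) contDiffAt_const
    (by simp)

lemma contDiffAt_chartDiff {f : E → G} {p : E} (hf : ContMDiffAt 𝓘(ℝ, E) (𝓡 n) ∞ f p) :
    ContDiffAt ℝ ∞ (Function.uncurry (chartDiff n f)) (p, p) := by
  rw [← contMDiffAt_iff_contDiffAt]
  have h1 : ContMDiffAt 𝓘(ℝ, E × E) (𝓡 n) ∞ (fun z : E × E => f z.1) (p, p) :=
    ContMDiffAt.comp (p, p) hf contDiff_fst.contMDiff.contMDiffAt
  have h2 : ContMDiffAt 𝓘(ℝ, E × E) (𝓡 n) ∞ (fun z : E × E => f z.2) (p, p) :=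
    ContMDiffAt.comp (p, p) hf contDiff_snd.contMDiff.contMDiffAt
  have h3 := h1.inv.mul h2
  refine ContMDiffAt.comp (I' := 𝓡 n) (M' := G) (p, p) ?_ h3
  simp only [inv_mul_cancel]
  exact contMDiffAt_chart_one

lemma contDiffAt_pullMC {f : E → G} {p : E} (hf : ContMDiffAt 𝓘(ℝ, E) (𝓡 n) ∞ f p) :
    ContDiffAt ℝ ∞ (pullMC n f) p :=
  ContDiffAt.fderiv (n := ∞) (contDiffAt_chartDiff hf) contDiffAt_id (by simp)

/-- In the chart at `1`, the left-invariant frame turns the Maurer-Cartan form of `f` into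
the differential of `f`. -/
lemma fderiv_chartDiff_eventually {f : E → G} {p : E} (hf : ContMDiffAt 𝓘(ℝ, E) (𝓡 n) ∞ f p) :
    ∀ᶠ q in 𝓝 p, fderiv ℝ (chartDiff n f p) q
      = (chartFrame n G (chartDiff n f p q)).comp (pullMC n f q) := by
  set c := extChartAt (𝓡 n) (1 : G)
  have hcont : ContinuousAt f p := hf.continuousAt
  have hcs : ContinuousAt (fun z : E × E => (f z.1)⁻¹ * f z.2) (p, p) :=
    haveI := topologicalGroup_of_lieGroup (𝓡 n) ∞ (G := G)
    (ContinuousAt.comp (x := (p, p)) (f := Prod.fst) hcont continuousAt_fst).inv.mul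
      (ContinuousAt.comp (x := (p, p)) (f := Prod.snd) hcont continuousAt_snd)
  have hsrc : ∀ᶠ z : E × E in 𝓝 (p, p), (f z.1)⁻¹ * f z.2 ∈ c.source := by
    apply hcs.eventually_mem
    simp only [inv_mul_cancel]
    exact extChartAt_source_mem_nhds (I := 𝓡 n) (1 : G)
  have hdiag : Tendsto (fun q : E => (q, q)) (𝓝 p) (𝓝 (p, p)) :=
    (continuous_id.prodMk continuous_id).tendsto p
  have hpq : Tendsto (fun q : E => (p, q)) (𝓝 p) (𝓝 (p, p)) :=
    (continuous_const.prodMk continuous_id).tendsto p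
  -- The order is lowered to 1 because `ContDiffAt.eventually` excludes order ∞; only
  -- differentiability at nearby points is needed.
  have hD : ContDiffAt ℝ 1 (Function.uncurry (chartDiff n f)) (p, p) :=
    (contDiffAt_chartDiff hf).of_le (by exact_mod_cast le_top)
  have hM : ContDiffAt ℝ 1 (Function.uncurry (chartMul n G)) (chartOne n G, chartOne n G) :=
    contDiffAt_chartMul.of_le (by exact_mod_cast le_top)
  have hDe := hdiag.eventually (hD.eventually (by simp))
  have hmul : Tendsto (fun q : E => (chartDiff n f p q, chartOne n G)) (𝓝 p)
      (𝓝 (chartOne n G, chartOne n G)) := by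
    have h0 : Tendsto (chartDiff n f p) (𝓝 p) (𝓝 (chartOne n G)) := by
      have := (hD.continuousAt.tendsto.comp hpq)
      simpa [Function.comp_def, Function.uncurry, chartDiff_self] using this
    exact h0.prodMk_nhds tendsto_const_nhds
  have hMe := hmul.eventually (hM.eventually (by simp))
  have hs1 := hdiag.eventually hsrc.eventually_nhds
  have hs2 := hpq.eventually hsrc
  filter_upwards [hDe, hMe, hs1, hs2] with q hq1 hq2 hq3 hq4
  -- The factorisation f(p)⁻¹f(r) = (f(p)⁻¹f(q)) · (f(q)⁻¹f(r)), to be differentiated in r at r = q,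
  -- where the second factor is the unit.
  have e1 : chartDiff n f p =ᶠ[𝓝 q]
      fun r => chartMul n G (chartDiff n f p q) (chartDiff n f q r) := by
    have : Tendsto (fun r : E => (q, r)) (𝓝 q) (𝓝 (q, q)) :=
      (continuous_const.prodMk continuous_id).tendsto q
    filter_upwards [this.eventually hq3] with r hr
    simp only [chartMul, chartDiff]
    rw [(extChartAt (𝓡 n) (1 : G)).left_inv hr, (extChartAt (𝓡 n) (1 : G)).left_inv hq4]
    congr 1
    group
  rw [e1.fderiv_eq]
  have d1 : DifferentiableAt ℝ (chartDiff n f q) q := by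
    have : DifferentiableAt ℝ (Function.uncurry (chartDiff n f)) (q, q) :=
      hq1.differentiableAt (by simp)
    exact this.comp q ((differentiableAt_const q).prodMk differentiableAt_id)
  have d2 : DifferentiableAt ℝ (chartMul n G (chartDiff n f p q)) (chartDiff n f q q) := by
    have : DifferentiableAt ℝ (Function.uncurry (chartMul n G))
      (chartDiff n f p q, chartOne n G) := hq2.differentiableAt (by simp)
    rw [chartDiff_self]
    exact this.comp (chartOne n G) ((differentiableAt_const _).prodMk differentiableAt_id)
  have := fderiv_comp q d2 d1
  rw [chartDiff_self] at this
  exact this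

end
end Local

/-! ### The Lie bracket in the chart at the unit and the Maurer–Cartan equation. -/

section MaurerCartan

variable {n : ℕ} {G : Type*} [TopologicalSpace G]
  [ChartedSpace (EuclideanSpace ℝ (Fin n)) G] [Group G] [LieGroup (𝓡 n) ∞ G]

/-- The differential of a vector-valued function in the chart at the base point. -/
lemma mfderiv_vector_apply {m : ℕ} {M F : Type*} [TopologicalSpace M]
    [ChartedSpace (EuclideanSpace ℝ (Fin m)) M] [NormedAddCommGroup F] [NormedSpace ℝ F]
    {h : M → F} {x : M} (hh : MDifferentiableAt (𝓡 m) 𝓘(ℝ, F) h x)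
    (v : EuclideanSpace ℝ (Fin m)) :
    mfderiv (𝓡 m) 𝓘(ℝ, F) h x v
      = fderiv ℝ (h ∘ (extChartAt (𝓡 m) x).symm) (extChartAt (𝓡 m) x x) v := by
  have : mfderiv (𝓡 m) 𝓘(ℝ, F) h x = fderivWithin ℝ (writtenInExtChartAt (𝓡 m) 𝓘(ℝ, F) x h)
      (Set.range (𝓡 m)) (extChartAt (𝓡 m) x x) := if_pos hh
  rw [this, ModelWithCorners.range_eq_univ, fderivWithin_univ]
  rfl

lemma mdifferentiable_mul_left (g : G) :
    MDifferentiable (𝓡 n) (𝓡 n) (fun h : G => g * h) :=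
  (contMDiff_mul_left (I := 𝓡 n) (n := ∞) (a := g)).mdifferentiable (by simp)

/-- The inverse of the differential of the inverse chart is the differential of the chart, so the
pullback is the chain rule for h ↦ chart(g h) at the unit. An identity on a neighbourhood is
required since the Lie bracket differentiates the fields. -/
lemma chartFrame_eventually (ξ : LieAlg n G) :
    VectorField.mpullbackWithin 𝓘(ℝ, EuclideanSpace ℝ (Fin n)) (𝓡 n)
      (extChartAt (𝓡 n) (1 : G)).symm (mulInvariantVectorField ξ) (Set.range (𝓡 n))
      =ᶠ[𝓝 (chartOne n G)] fun a => chartFrame n G a ξ := by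
  have : IsManifold (𝓡 n) 1 G := IsManifold.of_le (n := ∞) (by exact_mod_cast le_top)
  filter_upwards [extChartAt_target_mem_nhds (I := 𝓡 n) (1 : G)] with a ha
  rw [VectorField.mpullbackWithin_apply,
    ContinuousLinearMap.inverse_eq
      (mfderivWithin_extChartAt_symm_comp_mfderiv_extChartAt ha)
      (mfderiv_extChartAt_comp_mfderivWithin_extChartAt_symm ha)]
  set g : G := (extChartAt (𝓡 n) (1 : G)).symm a with hg
  have hgs : g ∈ (extChartAt (𝓡 n) (1 : G)).source := (extChartAt (𝓡 n) (1 : G)).map_target ha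
  have d1 : MDifferentiableAt (𝓡 n) 𝓘(ℝ, EuclideanSpace ℝ (Fin n))
      (extChartAt (𝓡 n) (1 : G)) (g * 1) := by
    rw [mul_one]
    apply mdifferentiableAt_extChartAt
    simpa using hgs
  have d2 := mdifferentiable_mul_left (n := n) g 1
  have d12 := d1.comp (1 : G) d2
  have e1 : mfderiv (𝓡 n) 𝓘(ℝ, EuclideanSpace ℝ (Fin n))
      (fun h : G => extChartAt (𝓡 n) (1 : G) (g * h)) 1 = chartFrame n G a := by
    ext1 v
    exact mfderiv_vector_apply d12 v
  have e2 := mfderiv_comp (1 : G) d1 d2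
  have e3 := e1.symm.trans e2
  rw [mulInvariantVectorField]
  have e4 := DFunLike.congr_fun e3 ξ
  refine Eq.trans ?_ e4.symm
  change _ = mfderiv (𝓡 n) 𝓘(ℝ, EuclideanSpace ℝ (Fin n)) (extChartAt (𝓡 n) (1 : G)) (g * 1) _
  rw [mul_one]
  rfl

/-- The Lie bracket of `G` in terms of the left-invariant frame in the chart at `1`. -/
lemma bracket_eq_chartFrame (ξ η : LieAlg n G) :
    ⁅ξ, η⁆ = fderiv ℝ (chartFrame n G) (chartOne n G) ξ η
      - fderiv ℝ (chartFrame n G) (chartOne n G) η ξ := by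
  have hd : DifferentiableAt ℝ (chartFrame n G) (chartOne n G) :=
    contDiffAt_chartFrame.differentiableAt (by simp)
  have hfd (ζ : EuclideanSpace ℝ (Fin n)) :
      fderiv ℝ (fun a => chartFrame n G a ζ) (chartOne n G)
        = (fderiv ℝ (chartFrame n G) (chartOne n G)).flip ζ := by
    rw [fderiv_clm_apply hd (differentiableAt_const ζ)]
    ext v
    simp
  rw [GroupLieAlgebra.bracket_def, VectorField.mlieBracket, VectorField.mlieBracketWithin_apply]
  have hs : (extChartAt (𝓡 n) (1 : G)).symm ⁻¹' Set.univ ∩ Set.range (𝓡 n) = Set.univ := by simp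
  rw [hs, mfderiv_extChartAt_self]
  change (ContinuousLinearMap.id ℝ (EuclideanSpace ℝ (Fin n))).inverse
    (VectorField.lieBracketWithin ℝ (E := EuclideanSpace ℝ (Fin n)) _ _ Set.univ (chartOne n G)) = _
  rw [ContinuousLinearMap.inverse_id]
  erw [VectorField.lieBracketWithin_univ, Filter.EventuallyEq.lieBracket_vectorField_eq (chartFrame_eventually ξ)
      (chartFrame_eventually η)]
  have h (a b : EuclideanSpace ℝ (Fin n)) :
      VectorField.lieBracket ℝ (fun x => chartFrame n G x a) (fun x => chartFrame n G x b)
        (chartOne n G) = fderiv ℝ (chartFrame n G) (chartOne n G) a b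
          - fderiv ℝ (chartFrame n G) (chartOne n G) b a := by
    rw [VectorField.lieBracket, hfd, hfd, chartFrame_one]
    rfl
  exact h ξ η

variable {E : Type*} [NormedAddCommGroup E] [NormedSpace ℝ E]

/-- The Maurer-Cartan equation for a map from a normed space to a Lie group. -/
theorem maurer_cartan {f : E → G} {p : E} (hf : ContMDiffAt 𝓘(ℝ, E) (𝓡 n) ∞ f p) (v w : E) :
    fderiv ℝ (pullMC n f) p v w - fderiv ℝ (pullMC n f) p w v
      = -Bracket.bracket (L := LieAlg n G) (M := LieAlg n G) (pullMC n f p v) (pullMC n f p w) := by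
  have hcd : ContDiffAt ℝ ∞ (chartDiff n f p) p :=
    ContDiffAt.comp p (g := Function.uncurry (chartDiff n f)) (f := fun q => (p, q))
      (contDiffAt_chartDiff hf) (contDiffAt_const.prodMk contDiffAt_id)
  have hsymm := hcd.isSymmSndFDerivAt (n := ∞)
    (by rw [minSmoothness_of_isRCLikeNormedField]
        exact WithTop.coe_le_coe.2 (le_top (a := (2 : ℕ∞))))
  have hfr : DifferentiableAt ℝ (chartFrame n G) (chartDiff n f p p) := by
    rw [chartDiff_self]
    exact contDiffAt_chartFrame.differentiableAt (by simp)
  have hcdd : DifferentiableAt ℝ (chartDiff n f p) p := hcd.differentiableAt (by simp)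
  have hpm : DifferentiableAt ℝ (pullMC n f) p :=
    (contDiffAt_pullMC hf).differentiableAt (by simp)
  have hcomp : HasFDerivAt (fun q => chartFrame n G (chartDiff n f p q))
      ((fderiv ℝ (chartFrame n G) (chartDiff n f p p)).comp (fderiv ℝ (chartDiff n f p) p)) p :=
    hfr.hasFDerivAt.comp p hcdd.hasFDerivAt
  -- Product rule for frame ∘ θ at q = p, where the frame is the identity. Symmetry in `a`, `b` then
  -- gives the equation.
  have h2 (a b : E) : fderiv ℝ (fderiv ℝ (chartDiff n f p)) p a b
      = fderiv ℝ (chartFrame n G) (chartOne n G) (pullMC n f p a) (pullMC n f p b)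
        + fderiv ℝ (pullMC n f) p a b := by
    rw [(EventuallyEq.fderiv_eq (fderiv_chartDiff_eventually hf)),
      (hcomp.clm_comp hpm.hasFDerivAt).fderiv]
    simp [chartDiff_self, chartFrame_one, pullMC, add_comm]
  refine Eq.trans ?_ (congrArg Neg.neg
    (bracket_eq_chartFrame (G := G) (pullMC n f p v) (pullMC n f p w)).symm)
  have h3 := hsymm v w
  rw [h2, h2] at h3
  generalize fderiv ℝ (pullMC n f) p v w = a at *
  generalize fderiv ℝ (pullMC n f) p w v = b at *
  refine Eq.trans ?_ (neg_sub _ _).symm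
  rw [sub_eq_sub_iff_add_eq_add]
  exact (add_comm _ _).trans (h3.trans (by trivial))

end MaurerCartan

/-! ### Pullbacks of the Maurer–Cartan form and the derivative of the adjoint action. -/

section PullMC

variable {n : ℕ} {G : Type*} [TopologicalSpace G]
  [ChartedSpace (EuclideanSpace ℝ (Fin n)) G] [Group G] [LieGroup (𝓡 n) ∞ G]
  {E D : Type*} [NormedAddCommGroup E] [NormedSpace ℝ E] [NormedAddCommGroup D] [NormedSpace ℝ D]

lemma mfderiv_chart_one (u : EuclideanSpace ℝ (Fin n)) :
    mfderiv (𝓡 n) 𝓘(ℝ, EuclideanSpace ℝ (Fin n)) (extChartAt (𝓡 n) (1 : G)) 1 u = u := by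
  have : IsManifold (𝓡 n) 1 G := IsManifold.of_le (n := ∞) (by exact_mod_cast le_top)
  rw [mfderiv_extChartAt_self]
  rfl

lemma mfderiv_chart_symm {m : ℕ} {M : Type*} [TopologicalSpace M]
    [ChartedSpace (EuclideanSpace ℝ (Fin m)) M] [IsManifold (𝓡 m) ∞ M] (x : M)
    (u : EuclideanSpace ℝ (Fin m)) :
    mfderiv 𝓘(ℝ, EuclideanSpace ℝ (Fin m)) (𝓡 m) (extChartAt (𝓡 m) x).symm
      (extChartAt (𝓡 m) x x) u = u := by
  have : IsManifold (𝓡 m) 1 M := IsManifold.of_le (n := ∞) (by exact_mod_cast le_top)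
  have h := mfderivWithin_range_extChartAt_symm (I := 𝓡 m) (x := x)
  rw [ModelWithCorners.range_eq_univ, mfderivWithin_univ] at h
  exact DFunLike.congr_fun h u

/-- Chain rule: the chart at the unit has identity differential there, so the coordinate definition
of `pullMC` agrees with the intrinsic form. -/
lemma thetaL_mfderiv {f : E → G} {p : E} (hf : ContMDiffAt 𝓘(ℝ, E) (𝓡 n) ∞ f p) (w : E) :
    thetaL (f p) (mfderiv 𝓘(ℝ, E) (𝓡 n) f p w) = pullMC n f p w := by
  have : IsManifold (𝓡 n) 1 G := IsManifold.of_le (n := ∞) (by exact_mod_cast le_top)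
  have d1 : MDifferentiableAt 𝓘(ℝ, E) (𝓡 n) f p := hf.mdifferentiableAt (by simp)
  have d2 := mdifferentiable_mul_left (n := n) (f p)⁻¹ (f p)
  have d3 : MDifferentiableAt (𝓡 n) 𝓘(ℝ, EuclideanSpace ℝ (Fin n))
      (extChartAt (𝓡 n) (1 : G)) ((f p)⁻¹ * f p) := by
    rw [inv_mul_cancel]
    exact contMDiffAt_chart_one.mdifferentiableAt (by simp)
  have e1 := mfderiv_comp p (d3.comp (f p) d2) d1
  have e2 := mfderiv_comp (f p) d3 d2
  have e3 : mfderiv 𝓘(ℝ, E) 𝓘(ℝ, EuclideanSpace ℝ (Fin n)) (chartDiff n f p) p w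
      = mfderiv (𝓡 n) 𝓘(ℝ, EuclideanSpace ℝ (Fin n)) (extChartAt (𝓡 n) (1 : G)) ((f p)⁻¹ * f p)
        (thetaL (f p) (mfderiv 𝓘(ℝ, E) (𝓡 n) f p w)) := by
    refine (DFunLike.congr_fun e1 w).trans ?_
    exact DFunLike.congr_fun e2 (mfderiv 𝓘(ℝ, E) (𝓡 n) f p w)
  rw [mfderiv_eq_fderiv] at e3
  rw [pullMC]
  refine Eq.trans ?_ e3.symm
  rw [inv_mul_cancel]
  exact (mfderiv_chart_one (G := G) _).symm

lemma pullMC_comp {f : E → G} {j : D → E} {j' : D →L[ℝ] E} {p : D}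
    (hf : ContMDiffAt 𝓘(ℝ, E) (𝓡 n) ∞ f (j p)) (hj : HasFDerivAt j j' p) (w : D) :
    pullMC n (f ∘ j) p w = pullMC n f (j p) (j' w) := by
  have h : DifferentiableAt ℝ (chartDiff n f (j p)) (j p) :=
    (ContDiffAt.comp (j p) (g := Function.uncurry (chartDiff n f)) (f := fun q => (j p, q))
      (contDiffAt_chartDiff hf) (contDiffAt_const.prodMk contDiffAt_id)).differentiableAt (by simp)
  exact DFunLike.congr_fun (h.hasFDerivAt.comp p hj).fderiv w

/-- The adjoint action of `g⁻¹`. -/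
def adInv (g : G) : LieAlg n G →L[ℝ] LieAlg n G :=
  (thetaL g).comp (rightField g)

/-- Moving the left factor away from the unit in direction ζ gives the velocity ζ^R(g), which left
translation carries to Ad of g⁻¹ on ζ. -/
lemma adInv_eq_pullMC (g : G) (ζ : EuclideanSpace ℝ (Fin n)) :
    adInv (n := n) g ζ
      = pullMC n (fun a => (extChartAt (𝓡 n) (1 : G)).symm a * g) (chartOne n G) ζ := by
  have hs := contMDiffAt_chart_symm (n := n) (G := G)
  have hF : ContMDiffAt 𝓘(ℝ, EuclideanSpace ℝ (Fin n)) (𝓡 n) ∞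
      (fun a => (extChartAt (𝓡 n) (1 : G)).symm a * g) (chartOne n G) :=
    hs.mul contMDiffAt_const
  rw [← thetaL_mfderiv hF]
  have d1 : MDifferentiableAt 𝓘(ℝ, EuclideanSpace ℝ (Fin n)) (𝓡 n)
      (extChartAt (𝓡 n) (1 : G)).symm (chartOne n G) := hs.mdifferentiableAt (by simp)
  have d2 : MDifferentiableAt (𝓡 n) (𝓡 n) (fun h : G => h * g)
      ((extChartAt (𝓡 n) (1 : G)).symm (chartOne n G)) :=
    (contMDiff_mul_right (I := 𝓡 n) (n := ∞) (a := g)).mdifferentiable (by simp) _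
  have e : mfderiv 𝓘(ℝ, EuclideanSpace ℝ (Fin n)) (𝓡 n)
      (fun a => (extChartAt (𝓡 n) (1 : G)).symm a * g) (chartOne n G) ζ
      = mfderiv (𝓡 n) (𝓡 n) (fun h : G => h * g)
        ((extChartAt (𝓡 n) (1 : G)).symm (chartOne n G))
        (mfderiv 𝓘(ℝ, EuclideanSpace ℝ (Fin n)) (𝓡 n)
          (extChartAt (𝓡 n) (1 : G)).symm (chartOne n G) ζ) :=
    DFunLike.congr_fun (mfderiv_comp (chartOne n G) d2 d1) ζ
  have e' : mfderiv 𝓘(ℝ, EuclideanSpace ℝ (Fin n)) (𝓡 n)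
          (extChartAt (𝓡 n) (1 : G)).symm (chartOne n G) ζ = ζ := mfderiv_chart_symm (1 : G) ζ
  rw [e, e', chart_symm_one, one_mul]
  rfl

/-- The differential of the adjoint action along a map to the group. -/
lemma hasFDerivAt_adInv {f : E → G} {p : E}
    (hf : ∀ᶠ q in 𝓝 p, ContMDiffAt 𝓘(ℝ, E) (𝓡 n) ∞ f q) (ζ : EuclideanSpace ℝ (Fin n)) :
    ∃ L : E →L[ℝ] EuclideanSpace ℝ (Fin n),
      HasFDerivAt (F := EuclideanSpace ℝ (Fin n)) (fun q => adInv (n := n) (f q) ζ) L p ∧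
      ∀ v, L v = -Bracket.bracket (L := LieAlg n G) (M := LieAlg n G) (pullMC n f p v)
        (adInv (f p) ζ) := by
  set c := extChartAt (𝓡 n) (1 : G)
  -- An auxiliary left factor makes the adjoint action a component of a Maurer–Cartan form; the
  -- claim becomes the Maurer–Cartan equation of `F` on (v, 0) and (0, ζ).
  let F : E × EuclideanSpace ℝ (Fin n) → G := fun z => c.symm z.2 * f z.1
  have hF (q : E) (a : EuclideanSpace ℝ (Fin n)) (hq : ContMDiffAt 𝓘(ℝ, E) (𝓡 n) ∞ f q)
      (ha : a ∈ c.target) :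
      ContMDiffAt 𝓘(ℝ, E × EuclideanSpace ℝ (Fin n)) (𝓡 n) ∞ F (q, a) := by
    have ha' : ContMDiffAt 𝓘(ℝ, EuclideanSpace ℝ (Fin n)) (𝓡 n) ∞ c.symm a :=
      (contMDiffOn_extChartAt_symm (I := 𝓡 n) (n := ∞) (1 : G)).contMDiffAt
        ((isOpen_extChartAt_target (I := 𝓡 n) (1 : G)).mem_nhds ha)
    have h1 : ContMDiffAt 𝓘(ℝ, E × EuclideanSpace ℝ (Fin n)) (𝓡 n) ∞
        (fun z : E × EuclideanSpace ℝ (Fin n) => c.symm z.2) (q, a) :=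
      ContMDiffAt.comp (q, a) ha' contDiff_snd.contMDiff.contMDiffAt
    have h2 : ContMDiffAt 𝓘(ℝ, E × EuclideanSpace ℝ (Fin n)) (𝓡 n) ∞
        (fun z : E × EuclideanSpace ℝ (Fin n) => f z.1) (q, a) :=
      ContMDiffAt.comp (q, a) hq contDiff_fst.contMDiff.contMDiffAt
    exact h1.mul h2
  have hone : chartOne n G ∈ c.target := mem_extChartAt_target (I := 𝓡 n) (1 : G)
  have hFp := hF p _ hf.self_of_nhds hone
  have hT : HasFDerivAt (pullMC n F) _ (p, chartOne n G) :=
    ((contDiffAt_pullMC hFp).differentiableAt (by simp)).hasFDerivAt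
  have eA (q : E) (hq : ContMDiffAt 𝓘(ℝ, E) (𝓡 n) ∞ f q) :
      adInv (n := n) (f q) ζ = pullMC n F (q, chartOne n G) (0, ζ) := by
    have := pullMC_comp (n := n) (f := F) (j := fun a => (q, a)) (p := chartOne n G)
      (hF q _ hq hone) ((hasFDerivAt_const q _).prodMk (hasFDerivAt_id (𝕜 := ℝ) (chartOne n G))) ζ
    exact (adInv_eq_pullMC (f q) ζ).trans this
  have eT (a : EuclideanSpace ℝ (Fin n)) (ha : a ∈ c.target) (v : E) :
      pullMC n F (p, a) (v, 0) = pullMC n f p v := by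
    have := pullMC_comp (n := n) (f := F) (j := fun q => (q, a)) (p := p)
      (hF p _ hf.self_of_nhds ha) ((hasFDerivAt_id (𝕜 := ℝ) p).prodMk (hasFDerivAt_const a p)) v
    refine Eq.trans this.symm ?_
    exact DFunLike.congr_fun (congrFun (pullMC_mul_left (n := n) (c.symm a) f) p) v
  have d1 := (hT.comp p ((hasFDerivAt_id (𝕜 := ℝ) p).prodMk
    (hasFDerivAt_const (chartOne n G) p))).clm_apply
      (hasFDerivAt_const ((0 : E), ζ) p)
  refine ⟨_, d1.congr_of_eventuallyEq (hf.mono fun q hq => eA q hq), fun v => ?_⟩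
  have d2 (v : E) := (hT.comp (chartOne n G) ((hasFDerivAt_const p (chartOne n G)).prodMk
    (hasFDerivAt_id (𝕜 := ℝ) (chartOne n G)))).clm_apply
      (hasFDerivAt_const (v, (0 : EuclideanSpace ℝ (Fin n))) (chartOne n G))
  have hnear : ∀ᶠ a in 𝓝 (chartOne n G), a ∈ c.target :=
    (isOpen_extChartAt_target (I := 𝓡 n) (1 : G)).mem_nhds hone
  have d3 (v : E) := (hasFDerivAt_const (𝕜 := ℝ) (pullMC n f p v)
    (chartOne n G)).congr_of_eventuallyEq
      (hnear.mono fun a ha => eT a ha v)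
  -- By left invariance the (v, 0) component does not depend on `a`, so its derivative in direction
  -- ζ vanishes and one term of the equation drops out.
  have h0 := DFunLike.congr_fun ((d2 v).unique (d3 v)) ζ
  have hmc := maurer_cartan hFp (v, 0) (0, ζ)
  rw [eT _ hone, ← eA p hf.self_of_nhds] at hmc
  refine Eq.trans ?_ hmc
  simp at h0
  simp [h0]

end PullMC

/-! ### Smoothness of the pulled-back Maurer–Cartan form. -/

section MCForm

variable {n : ℕ} {G : Type*} [TopologicalSpace G]
  [ChartedSpace (EuclideanSpace ℝ (Fin n)) G] [Group G] [LieGroup (𝓡 n) ∞ G]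
  {m : ℕ} {M : Type*} [TopologicalSpace M] [ChartedSpace (EuclideanSpace ℝ (Fin m)) M]

variable (n) in
/-- The pullback by `Φ` of the left Maurer-Cartan form. -/
def mc (Φ : M → G) (x : M) : Tan m x →L[ℝ] LieAlg n G :=
  (thetaL (Φ x)).comp (mfderiv (𝓡 m) (𝓡 n) Φ x)

lemma mc_eq_mfderiv {Φ : M → G} {x : M} (hΦ : MDifferentiableAt (𝓡 m) (𝓡 n) Φ x) :
    mfderiv (𝓡 m) (𝓡 n) (fun y => (Φ x)⁻¹ * Φ y) x
      = (thetaL (Φ x)).comp (mfderiv (𝓡 m) (𝓡 n) Φ x) :=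
  mfderiv_comp x (mdifferentiable_mul_left (n := n) (Φ x)⁻¹ (Φ x)) hΦ

variable [IsManifold (𝓡 m) ∞ M]

/-- The form is the differential at y = x of y ↦ Φ(x)⁻¹Φ(y), a map jointly smooth in (x, y), so
smooth dependence of derivatives on parameters applies. -/
lemma contMDiff_mc {Φ : M → G} (hΦ : ContMDiff (𝓡 m) (𝓡 n) ∞ Φ) (l : LieAlg n G →L[ℝ] ℝ) :
    ContMDiff (𝓡 m) ((𝓡 m).prod 𝓘(ℝ, EuclideanSpace ℝ (Fin m) →L[ℝ] ℝ)) ∞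
      (fun x : M => Bundle.TotalSpace.mk' (EuclideanSpace ℝ (Fin m) →L[ℝ] ℝ)
        (E := fun x : M => Cot m x) x (l.comp (mc n Φ x))) := by
  intro x₀
  have : IsManifold (𝓡 n) 1 G := IsManifold.of_le (n := ∞) (by exact_mod_cast le_top)
  rw [contMDiffAt_hom_bundle]
  refine ⟨contMDiffAt_id, ?_⟩
  have h1 : ContMDiffAt ((𝓡 m).prod (𝓡 m)) (𝓡 n) ∞
      (Function.uncurry fun x y => (Φ x)⁻¹ * Φ y) (x₀, x₀) :=
    ((hΦ.comp contMDiff_fst).inv.mul (hΦ.comp contMDiff_snd)).contMDiffAt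
  have h2 := ContMDiffAt.mfderiv (m := ∞) (fun x y => (Φ x)⁻¹ * Φ y) id h1 contMDiffAt_id (by simp)
  let l' : EuclideanSpace ℝ (Fin n) →L[ℝ] ℝ := l
  have h3 := ContMDiffAt.clm_comp (contMDiffAt_const (c := l')) h2
  refine h3.congr_of_eventuallyEq (Eventually.of_forall fun x => ?_)
  -- On the diagonal the target point is always the unit, so the trivialization on the side of G is
  -- the identity.
  have e : ((trivializationAt (EuclideanSpace ℝ (Fin n)) (TangentSpace (𝓡 n))
      ((Φ x₀)⁻¹ * Φ x₀)).continuousLinearMapAt ℝ ((Φ x)⁻¹ * Φ x) :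
        EuclideanSpace ℝ (Fin n) →L[ℝ] EuclideanSpace ℝ (Fin n))
      = ContinuousLinearMap.id ℝ _ := by
    rw [inv_mul_cancel, inv_mul_cancel,
      TangentBundle.continuousLinearMapAt_trivializationAt
        (by exact mem_chart_source (EuclideanSpace ℝ (Fin n)) (1 : G)), mfderiv_extChartAt_self]
  ext1 v
  have e1 := DFunLike.congr_fun e (mfderiv (𝓡 m) (𝓡 n) (fun y => (Φ x)⁻¹ * Φ y) x
    (((trivializationAt (EuclideanSpace ℝ (Fin m)) (TangentSpace (𝓡 m)) x₀).symmL ℝ x) v))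
  refine Eq.trans ?_ (congrArg l' e1).symm
  rw [mc_eq_mfderiv (hΦ.mdifferentiable (by simp) x)]
  exact DFunLike.congr_fun (Bundle.Trivial.continuousLinearMapAt_trivialization ℝ M ℝ x)
    (l (mc n Φ x (((trivializationAt (EuclideanSpace ℝ (Fin m)) (TangentSpace (𝓡 m)) x₀).symmL
      ℝ x) v)))

end MCForm

/-! ### Transfer of the differential identities from charts to the manifold. -/

section ChartDerivatives

variable {m : ℕ} {M : Type*} [TopologicalSpace M] [ChartedSpace (EuclideanSpace ℝ (Fin m)) M]
  [IsManifold (𝓡 m) ∞ M]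

lemma dFun_eq_of_chart {h : M → ℝ} {x : M} {k : EuclideanSpace ℝ (Fin m) → ℝ}
    {L : EuclideanSpace ℝ (Fin m) →L[ℝ] ℝ} (hk : HasFDerivAt k L (extChartAt (𝓡 m) x x))
    (he : ∀ᶠ p in 𝓝 (extChartAt (𝓡 m) x x), h ((extChartAt (𝓡 m) x).symm p) = k p)
    (v : EuclideanSpace ℝ (Fin m)) : dFun m h x v = L v := by
  have : IsManifold (𝓡 m) 1 M := IsManifold.of_le (n := ∞) (by exact_mod_cast le_top)
  have hc : MDifferentiableAt (𝓡 m) 𝓘(ℝ, EuclideanSpace ℝ (Fin m)) (extChartAt (𝓡 m) x) x :=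
    mdifferentiableAt_extChartAt (mem_chart_source _ x)
  have h1 : MDifferentiableAt (𝓡 m) 𝓘(ℝ, ℝ) (k ∘ extChartAt (𝓡 m) x) x :=
    hk.differentiableAt.mdifferentiableAt.comp x hc
  have h2 : h =ᶠ[𝓝 x] k ∘ extChartAt (𝓡 m) x := by
    filter_upwards [(continuousAt_extChartAt (I := 𝓡 m) x).eventually he,
      extChartAt_source_mem_nhds (I := 𝓡 m) x] with y hy hys
    rw [(extChartAt (𝓡 m) x).left_inv hys] at hy
    exact hy
  have h3 := mfderiv_vector_apply (h1.congr_of_eventuallyEq h2) v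
  have h4 : fderiv ℝ (h ∘ (extChartAt (𝓡 m) x).symm) (extChartAt (𝓡 m) x x) = L :=
    (hk.congr_of_eventuallyEq he).fderiv
  rw [h4] at h3
  exact h3

variable {n : ℕ} {G : Type*} [TopologicalSpace G]
  [ChartedSpace (EuclideanSpace ℝ (Fin n)) G] {Φ : M → G}

lemma contMDiffAt_chart_symm_eventually (hΦ : ContMDiff (𝓡 m) (𝓡 n) ∞ Φ) (x : M) :
    ∀ᶠ p in 𝓝 (extChartAt (𝓡 m) x x),
      ContMDiffAt 𝓘(ℝ, EuclideanSpace ℝ (Fin m)) (𝓡 m) ∞ (extChartAt (𝓡 m) x).symm p ∧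
      ContMDiffAt 𝓘(ℝ, EuclideanSpace ℝ (Fin m)) (𝓡 n) ∞ (Φ ∘ (extChartAt (𝓡 m) x).symm) p ∧
      extChartAt (𝓡 m) x ((extChartAt (𝓡 m) x).symm p) = p := by
  filter_upwards [extChartAt_target_mem_nhds (I := 𝓡 m) x] with p hp
  have h : ContMDiffAt 𝓘(ℝ, EuclideanSpace ℝ (Fin m)) (𝓡 m) ∞ (extChartAt (𝓡 m) x).symm p :=
    (contMDiffOn_extChartAt_symm (I := 𝓡 m) (n := ∞) x).contMDiffAt
      ((isOpen_extChartAt_target (I := 𝓡 m) x).mem_nhds hp)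
  exact ⟨h, hΦ.contMDiffAt.comp p h, (extChartAt (𝓡 m) x).right_inv hp⟩

variable [Group G] [LieGroup (𝓡 n) ∞ G]

lemma mc_constField_eventually (hΦ : ContMDiff (𝓡 m) (𝓡 n) ∞ Φ) (x : M)
    (w : EuclideanSpace ℝ (Fin m)) :
    ∀ᶠ p in 𝓝 (extChartAt (𝓡 m) x x),
      mc n Φ ((extChartAt (𝓡 m) x).symm p)
        (constField m (x := x) w ((extChartAt (𝓡 m) x).symm p))
        = pullMC n (Φ ∘ (extChartAt (𝓡 m) x).symm) p w := by
  filter_upwards [contMDiffAt_chart_symm_eventually hΦ x] with p ⟨h1, h2, h3⟩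
  rw [← thetaL_mfderiv h2]
  have hc : constField m (x := x) w ((extChartAt (𝓡 m) x).symm p)
      = mfderiv 𝓘(ℝ, EuclideanSpace ℝ (Fin m)) (𝓡 m) (extChartAt (𝓡 m) x).symm p w :=
    congrArg (fun q => (mfderiv 𝓘(ℝ, EuclideanSpace ℝ (Fin m)) (𝓡 m) (extChartAt (𝓡 m) x).symm q w :
      EuclideanSpace ℝ (Fin m))) h3
  rw [hc]
  exact congrArg (thetaL (Φ ((extChartAt (𝓡 m) x).symm p)))
    (DFunLike.congr_fun (mfderiv_comp p (hΦ.mdifferentiable (by simp) _)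
      (h1.mdifferentiableAt (by simp))) w).symm

lemma mc_eq_pullMC (hΦ : ContMDiff (𝓡 m) (𝓡 n) ∞ Φ) (x : M)
    (w : EuclideanSpace ℝ (Fin m)) :
    mc n Φ x w = pullMC n (Φ ∘ (extChartAt (𝓡 m) x).symm) (extChartAt (𝓡 m) x x) w := by
  have h := (mc_constField_eventually hΦ x w).self_of_nhds
  rw [extChartAt_to_inv] at h
  refine Eq.trans ?_ h
  exact congrArg (mc n Φ x) (mfderiv_chart_symm x w).symm

/-- The Maurer-Cartan equation for a smooth map from a manifold to a Lie group. -/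
lemma extD_mc (hΦ : ContMDiff (𝓡 m) (𝓡 n) ∞ Φ) (l : LieAlg n G →L[ℝ] ℝ) (x : M)
    (v w : Tan m x) :
    extD m (fun y => l.comp (mc n Φ y)) x v w = -l ⁅mc n Φ x v, mc n Φ x w⁆ := by
  set f := Φ ∘ (extChartAt (𝓡 m) x).symm
  let l' : EuclideanSpace ℝ (Fin n) →L[ℝ] ℝ := l
  have hfs := (contMDiffAt_chart_symm_eventually (n := n) hΦ x).self_of_nhds.2.1
  have hT := ((contDiffAt_pullMC hfs).differentiableAt (by simp)).hasFDerivAt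
  have hd (u u' : EuclideanSpace ℝ (Fin m)) :
      dFun m (fun y => l (mc n Φ y (constField m (x := x) u y))) x u'
        = l' (fderiv ℝ (pullMC n f) (extChartAt (𝓡 m) x x) u' u) := by
    have hk := l'.hasFDerivAt.comp (extChartAt (𝓡 m) x x)
      (hT.clm_apply (hasFDerivAt_const u (extChartAt (𝓡 m) x x)))
    rw [dFun_eq_of_chart hk ((mc_constField_eventually hΦ x u).mono
      fun p hp => congrArg l hp)]
    simp [f]
  have hmc := maurer_cartan hfs v w
  have h2 : extD m (fun y => l.comp (mc n Φ y)) x v w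
      = l' (fderiv ℝ (pullMC n f) (extChartAt (𝓡 m) x x) v w
        - fderiv ℝ (pullMC n f) (extChartAt (𝓡 m) x x) w v) := by
    rw [map_sub]
    exact congrArg₂ (· - ·) (hd w v) (hd v w)
  rw [h2, mc_eq_pullMC hΦ x v, mc_eq_pullMC hΦ x w, ← map_neg]
  exact congrArg l' hmc

/-- The shape of `h` covers both functions differentiated in the algebroid bracket: π(i(ξ), i(η))
and i(η)(ρ(ζ)). -/
lemma dFun_adInv (hΦ : ContMDiff (𝓡 m) (𝓡 n) ∞ Φ) {h : M → ℝ} (c : ℝ)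
    (l₁ l₂ : LieAlg n G →L[ℝ] ℝ) (ζ₁ ζ₂ : LieAlg n G)
    (hh : ∀ y, h y = c + l₁ (adInv (Φ y) ζ₁) + l₂ (adInv (Φ y) ζ₂)) (x : M) (v : Tan m x) :
    dFun m h x v = -l₁ ⁅mc n Φ x v, adInv (Φ x) ζ₁⁆ - l₂ ⁅mc n Φ x v, adInv (Φ x) ζ₂⁆ := by
  have hfs := (contMDiffAt_chart_symm_eventually (n := n) hΦ x).mono fun p hp => hp.2.1
  have hx : (Φ ∘ (extChartAt (𝓡 m) x).symm) (extChartAt (𝓡 m) x x) = Φ x := by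
    simp only [Function.comp, extChartAt_to_inv]
  obtain ⟨L₁, hL₁, e₁⟩ := hasFDerivAt_adInv hfs ζ₁
  obtain ⟨L₂, hL₂, e₂⟩ := hasFDerivAt_adInv hfs ζ₂
  let l₁' : EuclideanSpace ℝ (Fin n) →L[ℝ] ℝ := l₁
  let l₂' : EuclideanSpace ℝ (Fin n) →L[ℝ] ℝ := l₂
  have hk := ((l₁'.hasFDerivAt.comp _ hL₁).const_add c).add (l₂'.hasFDerivAt.comp _ hL₂)
  refine (dFun_eq_of_chart hk (Eventually.of_forall fun p => hh _) v).trans ?_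
  have e₁' := congrArg l₁' (e₁ v)
  have e₂' := congrArg l₂' (e₂ v)
  rw [hx] at e₁' e₂'
  rw [mc_eq_pullMC hΦ x v, sub_eq_add_neg, ← map_neg, ← map_neg]
  exact congrArg₂ (· + ·) e₁' e₂'

end ChartDerivatives

/-! ### Linear algebra of the invariant inner product. -/

section QuadraticAlgebra

variable {𝔤 : Type*} [LieRing 𝔤] [LieAlgebra ℝ 𝔤] (B : InvariantInnerProduct 𝔤)

namespace InvariantInnerProduct

variable {B} in
lemma sum_form_smul {ι : Type*} [Fintype ι] [DecidableEq ι] {e e' : Module.Basis ι ℝ 𝔤}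
    (he : ∀ j k : ι, B.form (e j) (e' k) = if j = k then 1 else 0) (u : 𝔤) :
    ∑ i, B.form u (e' i) • e i = u := by
  have h (k : ι) : B.form u (e' k) = e.repr u k := by
    conv_lhs => rw [← e.sum_repr u, map_sum, LinearMap.sum_apply]
    simp only [map_smul, LinearMap.smul_apply, he]
    simp
  simp only [h, e.sum_repr]

variable [FiniteDimensional ℝ 𝔤]

lemma form_sSharp (a : Module.Dual ℝ 𝔤) (η : 𝔤) : B.form (B.sSharp a) η = a η := by
  have := (B.form.toDual B.nondegenerate).apply_symm_apply a
  exact DFunLike.congr_fun this η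

variable {B} in
lemma ext_form {u v : 𝔤} (h : ∀ η, B.form u η = B.form v η) : u = v :=
  (B.form.toDual B.nondegenerate).injective (LinearMap.ext h)

/-- The transpose of an endomorphism for the inner product. -/
def adj (A : 𝔤 →ₗ[ℝ] 𝔤) : 𝔤 →ₗ[ℝ] 𝔤 :=
  B.sSharp.toLinearMap ∘ₗ A.dualMap ∘ₗ B.form

lemma form_adj (A : 𝔤 →ₗ[ℝ] 𝔤) (ξ η : 𝔤) : B.form (B.adj A ξ) η = B.form ξ (A η) :=
  B.form_sSharp _ η

variable {B}

/-- In the hypothesis the terms linear in A cancel, leaving ⟨A*ξ, A*ξ⟩ = ⟨ξ, ξ⟩. Polarisation and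
nondegeneracy give A A* = 1. -/
lemma apply_adj {A : 𝔤 →ₗ[ℝ] 𝔤}
    (h : ∀ ξ, B.form ξ (ξ + B.adj A ξ - A (ξ + B.adj A ξ)) = 0) (ξ : 𝔤) :
    A (B.adj A ξ) = ξ := by
  have h1 (ξ : 𝔤) : B.form (B.adj A ξ) (B.adj A ξ) = B.form ξ ξ := by
    have := h ξ
    rw [map_sub, map_add, map_add, map_add, B.symm ξ (B.adj A ξ), form_adj, ← form_adj B A ξ
      (B.adj A ξ)] at this
    linarith
  have h2 (η : 𝔤) : B.form (B.adj A ξ) (B.adj A η) = B.form ξ η := by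
    have := h1 (ξ + η)
    simp only [map_add, LinearMap.add_apply, h1] at this
    rw [B.symm (B.adj A η) (B.adj A ξ), B.symm η ξ] at this
    linarith
  refine ext_form (B := B) fun η => ?_
  rw [B.symm, ← form_adj, B.symm, h2]

/-- The algebraic identity behind the compatibility of `ξ ↦ Φ^* ⟨ξ, θ^L⟩` with brackets. -/
lemma bracket_identity {A : 𝔤 →ₗ[ℝ] 𝔤}
    (h : ∀ ξ, B.form ξ (ξ + B.adj A ξ - A (ξ + B.adj A ξ)) = 0)
    {ι : Type*} [Fintype ι] [DecidableEq ι] {e e' : Module.Basis ι ℝ 𝔤}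
    (he : ∀ j k : ι, B.form (e j) (e' k) = if j = k then 1 else 0) (ξ η w : 𝔤) :
    B.form ⁅ξ, η⁆ w = (1 / 2) * (B.form η ⁅w, A ξ⁆ - B.form ξ ⁅w, A η⁆)
      + (1 / 2) * -B.form η ⁅ξ + B.adj A ξ - A (ξ + B.adj A ξ), w⁆
      - (1 / 2) * -B.form ξ ⁅η + B.adj A η - A (η + B.adj A η), w⁆
      + (1 / 2) * ∑ i, (B.form ξ (e' i - A (e' i))
          * (-B.form η ⁅e i - A (e i), w⁆ + B.form η ⁅w, A (e i)⁆)
        - B.form η (e' i - A (e' i))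
          * (-B.form ξ ⁅e i - A (e i), w⁆ + B.form ξ ⁅w, A (e i)⁆)) := by
  -- The Lie derivative terms are free of A.
  have h1 (ζ u : 𝔤) : -B.form ζ ⁅u - A u, w⁆ + B.form ζ ⁅w, A u⁆ = B.form ζ ⁅w, u⁆ := by
    rw [← lie_skew (u - A u) w, lie_sub]
    simp
  have h2 (ζ u : 𝔤) : ∑ i, B.form ζ (e' i - A (e' i)) * B.form u ⁅w, e i⁆
      = B.form u ⁅w, ζ - B.adj A ζ⁆ := by
    conv_rhs => rw [← sum_form_smul he (ζ - B.adj A ζ)]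
    simp only [lie_sum, lie_smul, map_sum, map_smul, smul_eq_mul]
    refine Finset.sum_congr rfl fun i _ => ?_
    rw [map_sub, map_sub, LinearMap.sub_apply, form_adj]
  -- Here A A* = 1 enters: ζ cancels against A A*ζ.
  have h3 (ζ u : 𝔤) : -B.form u ⁅ζ + B.adj A ζ - A (ζ + B.adj A ζ), w⁆
      = B.form u ⁅w, B.adj A ζ - A ζ⁆ := by
    rw [← lie_skew, map_add, apply_adj h]
    simp
    ring
  have h4 : B.form η ⁅w, ξ⁆ = B.form ⁅ξ, η⁆ w := by
    rw [B.symm, B.invariant, B.symm]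
  have h5 : B.form ξ ⁅w, η⁆ = -B.form ⁅ξ, η⁆ w := by
    rw [B.symm, B.invariant, B.symm, ← lie_skew η ξ, map_neg, LinearMap.neg_apply]
  simp only [h1, Finset.sum_sub_distrib, h2, h3]
  simp only [lie_sub, map_sub]
  rw [h4, h5]
  ring

end InvariantInnerProduct
end QuadraticAlgebra

/-! ### The one-forms i(ξ) on a Hamiltonian quasi-Poisson manifold. -/

section MomentMap

variable {n : ℕ} {G : Type*} [TopologicalSpace G]
  [ChartedSpace (EuclideanSpace ℝ (Fin n)) G] [Group G] [LieGroup (𝓡 n) ∞ G]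
  (B : InvariantInnerProduct (LieAlg n G))
  {m : ℕ} {M : Type*} [TopologicalSpace M] [ChartedSpace (EuclideanSpace ℝ (Fin m)) M]

lemma thetaL_leftField (g : G) (ξ : LieAlg n G) : thetaL g (leftField g ξ) = ξ := by
  have d1 := mdifferentiable_mul_left (n := n) g 1
  have d2 := mdifferentiable_mul_left (n := n) g⁻¹ (g * 1)
  have h := mfderiv_comp (1 : G) d2 d1
  have e : (fun h : G => g⁻¹ * h) ∘ (fun h : G => g * h) = id := by
    ext h
    simp
  rw [e, mfderiv_id, mul_one] at h
  exact (DFunLike.congr_fun h ξ).symm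

/-- The inner product with `ξ` as a continuous linear form. -/
def InvariantInnerProduct.formCLM (ξ : LieAlg n G) : LieAlg n G →L[ℝ] ℝ :=
  { B.form ξ with
    cont :=
      let f : EuclideanSpace ℝ (Fin n) →ₗ[ℝ] ℝ := B.form ξ
      f.continuous_of_finiteDimensional }

/-- The transpose of the adjoint action of `g⁻¹`. -/
abbrev adInvAdj (g : G) : LieAlg n G →ₗ[ℝ] LieAlg n G :=
  B.adj (adInv (n := n) g).toLinearMap

variable [IsManifold (𝓡 m) ∞ M]

/-- The one-form `Φ^* ⟨ξ, θ^L⟩`. -/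
def mcForm {Φ : M → G} (hΦ : ContMDiff (𝓡 m) (𝓡 n) ∞ Φ) (ξ : LieAlg n G) : OneForm m M where
  toFun x := (B.formCLM ξ).comp (mc n Φ x)
  contMDiff_toFun := contMDiff_mc hΦ (B.formCLM ξ)

lemma mcForm_apply {Φ : M → G} (hΦ : ContMDiff (𝓡 m) (𝓡 n) ∞ Φ) (ξ : LieAlg n G) (x : M)
    (v : Tan m x) : mcForm B hΦ ξ x v = B.form ξ (mc n Φ x v) := rfl

/-- The linear map `ξ ↦ Φ^* ⟨ξ, θ^L⟩`. -/
def mcFormLinear {Φ : M → G} (hΦ : ContMDiff (𝓡 m) (𝓡 n) ∞ Φ) :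
    LieAlg n G →ₗ[ℝ] OneForm m M where
  toFun := mcForm B hΦ
  map_add' ξ η := by
    ext x v
    change B.form (ξ + η) (mc n Φ x v) = B.form ξ (mc n Φ x v) + B.form η (mc n Φ x v)
    simp
  map_smul' c ξ := by
    ext x v
    change B.form (c • ξ) (mc n Φ x v) = c • B.form ξ (mc n Φ x v)
    simp

variable {B} {Q : QuasiPoisson m M B} {Φ : M → G}

lemma IsMomentMap.mc_action (hΦ : IsMomentMap Q Φ) (ζ : LieAlg n G) (x : M) :
    mc n Φ x (Q.ρ ζ x) = ζ - adInv (Φ x) ζ := by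
  change thetaL (Φ x) (mfderiv (𝓡 m) (𝓡 n) Φ x (Q.ρ ζ x)) = _
  rw [hΦ.equivariant, map_sub, thetaL_leftField]
  rfl

lemma IsMomentMap.sharp_mcForm (hΦ : IsMomentMap Q Φ) (ξ : LieAlg n G) (x : M) :
    Q.biv.sharp x (mcForm B hΦ.smooth ξ x)
      = Q.ρ ((1 / 2 : ℝ) • (ξ + adInvAdj B (Φ x) ξ)) x := by
  -- The moment condition is stated for one-forms on G, so ⟨ξ, θ^L⟩ on G itself is obtained as the
  -- case of the identity map.
  let θ : OneForm n G := mcForm B contMDiff_id ξ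
  have hθ (g : G) (u : Tan n g) : θ g u = B.form ξ (thetaL g u) := by
    change B.form ξ (thetaL g (mfderiv (𝓡 n) (𝓡 n) id g u)) = _
    rw [mfderiv_id]
    rfl
  have h1 : pullCot Φ x (θ (Φ x)) = mcForm B hΦ.smooth ξ x := by
    ext v
    exact hθ (Φ x) (mfderiv (𝓡 m) (𝓡 n) Φ x v)
  rw [← h1, hΦ.moment]
  congr 2
  refine InvariantInnerProduct.ext_form (B := B) fun η => ?_
  rw [B.form_sSharp]
  have h2 : bStar (Φ x) (θ (Φ x)) η
      = B.form ξ (thetaL (Φ x) ((1 / 2 : ℝ) • (leftField (Φ x) η + rightField (Φ x) η))) :=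
    hθ (Φ x) _
  rw [h2, map_smul, map_add, thetaL_leftField]
  simp only [map_smul, map_add, LinearMap.smul_apply, LinearMap.add_apply, B.form_adj]
  rfl

lemma IsMomentMap.sSharp_transpose_mcForm (hΦ : IsMomentMap Q Φ) (ξ : LieAlg n G) (x : M) :
    B.sSharp (transpose Q.ρ x (mcForm B hΦ.smooth ξ x)) = ξ - adInvAdj B (Φ x) ξ := by
  refine InvariantInnerProduct.ext_form (B := B) fun η => ?_
  rw [B.form_sSharp]
  change B.form ξ (mc n Φ x (Q.ρ η x)) = _
  rw [hΦ.mc_action]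
  simp only [map_sub, LinearMap.sub_apply, B.form_adj]
  rfl

lemma IsMomentMap.anchor_mcForm (hΦ : IsMomentMap Q Φ) (ξ : LieAlg n G) (x : M) :
    Q.anchor x (mcForm B hΦ.smooth ξ x) = Q.ρ ξ x := by
  rw [QuasiPoisson.anchor, hΦ.sharp_mcForm, hΦ.sSharp_transpose_mcForm]
  have h : ξ = (1 / 2 : ℝ) • (ξ + adInvAdj B (Φ x) ξ) + (1 / 2 : ℝ) • (ξ - adInvAdj B (Φ x) ξ) := by
    module
  conv_rhs => rw [h]
  rw [map_add, map_smul Q.ρ _ (ξ - adInvAdj B (Φ x) ξ)]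
  rfl

/-- Evaluating the bivector field on `Φ^* ⟨ξ, θ^L⟩` and `Φ^* ⟨η, θ^L⟩`. -/
lemma IsMomentMap.mcForm_sharp_mcForm (hΦ : IsMomentMap Q Φ) (ξ η : LieAlg n G) (x : M) :
    mcForm B hΦ.smooth η x (Q.biv.sharp x (mcForm B hΦ.smooth ξ x))
      = (1 / 2) * B.form η (ξ + adInvAdj B (Φ x) ξ - adInv (Φ x) (ξ + adInvAdj B (Φ x) ξ)) := by
  rw [hΦ.sharp_mcForm, mcForm_apply, hΦ.mc_action, map_smul, ← smul_sub, map_smul, smul_eq_mul]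

lemma IsMomentMap.form_isotropic (hΦ : IsMomentMap Q Φ) (x : M) (ξ : LieAlg n G) :
    B.form ξ (ξ + adInvAdj B (Φ x) ξ
      - (adInv (n := n) (Φ x)).toLinearMap (ξ + adInvAdj B (Φ x) ξ)) = 0 := by
  have h := Q.biv.alternating x (mcForm B hΦ.smooth ξ x)
  rw [hΦ.mcForm_sharp_mcForm] at h
  exact (mul_eq_zero.1 h).resolve_left (by norm_num)

/-- A A* = 1 and transposition remove A*, so that `dFun_adInv` applies to this function of the
point. -/
lemma IsMomentMap.eval_mcForm (hΦ : IsMomentMap Q Φ) (ξ η : LieAlg n G) (x : M) :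
    Q.biv.eval x (mcForm B hΦ.smooth ξ x) (mcForm B hΦ.smooth η x)
      = (1 / 2) * (B.form ξ (adInv (Φ x) η) - B.form η (adInv (Φ x) ξ)) := by
  have h1 : adInv (Φ x) (adInvAdj B (Φ x) ξ) = ξ :=
    InvariantInnerProduct.apply_adj (hΦ.form_isotropic x) ξ
  have h2 : B.form η (adInvAdj B (Φ x) ξ) = B.form ξ (adInv (Φ x) η) := by
    rw [B.symm, B.form_adj]
    rfl
  rw [Bivector.eval, hΦ.mcForm_sharp_mcForm, map_add, h1, add_comm (adInv (Φ x) ξ),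
    add_sub_add_left_eq_sub, map_sub, h2]

lemma extD_mcForm (hΦ : ContMDiff (𝓡 m) (𝓡 n) ∞ Φ) (ξ : LieAlg n G) (x : M) (v w : Tan m x) :
    extD m (mcForm B hΦ ξ) x v w = -B.form ξ ⁅mc n Φ x v, mc n Φ x w⁆ :=
  extD_mc hΦ (B.formCLM ξ) x v w

lemma IsMomentMap.dFun_eval_mcForm (hΦ : IsMomentMap Q Φ) (ξ η : LieAlg n G) (x : M) (v : Tan m x) :
    dFun m (fun y => Q.biv.eval y (mcForm B hΦ.smooth ξ y) (mcForm B hΦ.smooth η y)) x v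
      = (1 / 2) * (B.form η ⁅mc n Φ x v, adInv (Φ x) ξ⁆
        - B.form ξ ⁅mc n Φ x v, adInv (Φ x) η⁆) := by
  rw [dFun_adInv hΦ.smooth 0 ((1 / 2 : ℝ) • B.formCLM ξ) (-((1 / 2 : ℝ) • B.formCLM η)) η ξ]
  · change -((1 / 2 : ℝ) * B.form ξ _) - -((1 / 2 : ℝ) * B.form η _) = _
    ring
  · intro y
    rw [hΦ.eval_mcForm]
    change _ = 0 + (1 / 2 : ℝ) * B.form ξ _ + -((1 / 2 : ℝ) * B.form η _)
    ring

lemma IsMomentMap.lieD_mcForm (hΦ : IsMomentMap Q Φ) (ζ η : LieAlg n G) (x : M) (v : Tan m x) :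
    lieD m (Q.ρ ζ) (mcForm B hΦ.smooth η) x v
      = -B.form η ⁅ζ - adInv (Φ x) ζ, mc n Φ x v⁆
        + B.form η ⁅mc n Φ x v, adInv (Φ x) ζ⁆ := by
  rw [lieD, extD_mcForm, hΦ.mc_action,
    -- i(η)(ρ(ζ)) = ⟨η, ζ⟩ - ⟨η, Aζ⟩ has a single adjoint term, so the second slot is filled with
    -- zeros.
    dFun_adInv hΦ.smooth (B.form η ζ) (-B.formCLM η) 0 ζ 0]
  · change _ + (- -B.form η _ - 0) = _
    ring
  · intro y
    rw [mcForm_apply, hΦ.mc_action, map_sub]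
    change _ = _ + -B.form η _ + 0
    ring

lemma IsMomentMap.bracket_mcForm (hΦ : IsMomentMap Q Φ) {ι : Type*} [Fintype ι] [DecidableEq ι]
    {e e' : Module.Basis ι ℝ (LieAlg n G)}
    (he : ∀ j k : ι, B.form (e j) (e' k) = if j = k then 1 else 0)
    (ξ η : LieAlg n G) (x : M) (v : Tan m x) :
    mcForm B hΦ.smooth ⁅ξ, η⁆ x v
      = Q.bracket e e' (mcForm B hΦ.smooth ξ) (mcForm B hΦ.smooth η) x v := by
  have h := InvariantInnerProduct.bracket_identity (hΦ.form_isotropic x) he ξ η (mc n Φ x v)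
  have h1 (ζ u : LieAlg n G) :
      extD m (mcForm B hΦ.smooth u) x (Q.biv.sharp x (mcForm B hΦ.smooth ζ x)) v
        = (1 / 2) * -B.form u ⁅ζ + adInvAdj B (Φ x) ζ - adInv (Φ x) (ζ + adInvAdj B (Φ x) ζ),
          mc n Φ x v⁆ := by
    rw [extD_mcForm, hΦ.sharp_mcForm, hΦ.mc_action, map_smul, ← smul_sub, smul_lie, map_smul,
      smul_eq_mul]
    ring
  rw [mcForm_apply, h, QuasiPoisson.bracket, hΦ.dFun_eval_mcForm, h1, h1]
  simp only [hΦ.lieD_mcForm, mcForm_apply, hΦ.mc_action]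
  rfl

end MomentMap

end QPoisson

end

theorem theorem1p9
    {n : ℕ} {G : Type*} [TopologicalSpace G] [ChartedSpace (EuclideanSpace ℝ (Fin n)) G]
    [Group G] [LieGroup (𝓡 n) ∞ G]
    (B : QPoisson.InvariantInnerProduct (QPoisson.LieAlg n G))
    {m : ℕ} {M : Type*} [TopologicalSpace M] [ChartedSpace (EuclideanSpace ℝ (Fin m)) M]
    [IsManifold (𝓡 m) ∞ M]
    (Q : QPoisson.QuasiPoisson m M B) (Φ : M → G) (hΦ : QPoisson.IsMomentMap Q Φ) :
    ∃ i : QPoisson.LieAlg n G →ₗ[ℝ] QPoisson.OneForm m M,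
      (∀ (ξ : QPoisson.LieAlg n G) (x : M) (v : QPoisson.Tan m x),
        i ξ x v = B.form ξ (QPoisson.thetaL (Φ x) (mfderiv (𝓡 m) (𝓡 n) Φ x v))) ∧
      (∀ (ι : Type) [Fintype ι] [DecidableEq ι]
          (e e' : Module.Basis ι ℝ (QPoisson.LieAlg n G)),
        (∀ j k : ι, B.form (e j) (e' k) = if j = k then 1 else 0) →
        ∀ (ξ η : QPoisson.LieAlg n G) (x : M) (v : QPoisson.Tan m x),
          i ⁅ξ, η⁆ x v = Q.bracket e e' (i ξ) (i η) x v) ∧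
      (∀ (ξ : QPoisson.LieAlg n G) (x : M), Q.anchor x (i ξ x) = Q.ρ ξ x) := by
  refine ⟨QPoisson.mcFormLinear B hΦ.smooth, fun ξ x v => rfl, fun ι _ _ e e' he ξ η x v => ?_,
    fun ξ x => hΦ.anchor_mcForm ξ x⟩
  exact hΦ.bracket_mcForm he ξ η x v
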